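/- Let $p$ and $r$ be distinct prime numbers. Put $\mathbf r=r\cdot\gcd(r,2)$ (so $\mathbf r=r$ if $r$ is odd and $\mathbf r=4$ if $r=2$), and for $k\ge 0$ let $A_{r,k}$ be the ring of integers of the cyclotomic field $\mathbb Q(\zeta_{\mathbf r r^k})$. The group $\mathbb Z_r^*$ of $r$-adic units, which is the Galois group of $\mathbb Q(\zeta_{\mathbf r r^i}: i\ge 0)$ over $\mathbb Q$, acts on $A_{r,k}$; a unit $u$ acts by $\zeta_{\mathbf r r^k}\mapsto \zeta_{\mathbf r r^k}^{\,u \bmod \mathbf r r^k}$. Let $\Delta_r$ be the torsion subgroup of $\mathbb Z_r^*$, and let $B_{r,k}=\{a\in A_{r,k} : \delta(a)=a \text{ for all } \delta\in\Delta_r\}$. Let $l\ge 0$ be the integer such that $r^l$ is the largest power of $r$ dividing the integer $(p^{\varphi(\mathbf r)}-1)/(\mathbf r^2/r)$, where $\varphi$ is Euler's totient function. For $n,m\ge 1$ the Galois ring $\mathrm{GR}(p^n,m)$ is $\mathbb Z[x]/(p^n,h(x))$, where $h\in\mathbb Z[x]$ is any monic polynomial of degree $m$ that is irreducible modulo $p$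 (the statements below hold for every such $h$). **Proposition.** Let $k\ge 0$ and $n\ge 1$. 1. For every prime ideal $\mathfrak p$ of $B_{r,k+l}$ containing $p$ there is a ring isomorphism $B_{r,k+l}/\mathfrak p^n\cong \mathrm{GR}(p^n,r^k)$. 2. If $k\le l$, then for every prime ideal $\mathfrak p$ of $B_{r,k}$ containing $p$ there is a ring isomorphism $B_{r,k}/\mathfrak p^n\cong \mathrm{GR}(p^n,1)\;(\cong\mathbb Z/p^n\mathbb Z)$. In particular, if $l=0$, then $B_{r,k}/\mathfrak p^n\cong \mathrm{GR}(p^n,r^k)$ for all $k\ge 0$, all $n\ge 1$ and every prime ideal $\mathfrak p$ of $B_{r,k}$ containing $p$. -/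

import Mathlib

open Polynomial NumberField

namespace GaloisModel

/-- `𝐫 = r * gcd (r, 2)`, that is, `r` for odd `r` and `4` for `r = 2`. -/
def bold (r : ℕ) : ℕ := r * Nat.gcd r 2

/-- The conductor `𝐫 * r ^ k` of the `k`-th cyclotomic field of the tower. -/
def conductor (r k : ℕ) : ℕ := bold r * r ^ k

theorem conductor_ne_zero (r k : ℕ) [hr : Fact r.Prime] : conductor r k ≠ 0 :=
  mul_ne_zero (mul_ne_zero hr.out.ne_zero (Nat.gcd_ne_zero_right two_ne_zero))
    (pow_ne_zero _ hr.out.ne_zero)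

instance (r k : ℕ) [Fact r.Prime] : NeZero (conductor r k) := ⟨conductor_ne_zero r k⟩

theorem conductor_dvd (r k : ℕ) : conductor r k ∣ r ^ (k + 2) := by
  have h : conductor r k ∣ (r * r) * r ^ k :=
    mul_dvd_mul_right (mul_dvd_mul_left r (Nat.gcd_dvd_left r 2)) _
  have e : (r * r) * r ^ k = r ^ (k + 2) := by ring
  rwa [e] at h

/-- The cyclotomic field `ℚ(ζ)`, `ζ` a primitive root of unity of order `𝐫 * r ^ k`. -/
abbrev K (r k : ℕ) : Type := CyclotomicField (conductor r k) ℚ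

/-- Mathlib's fact, for the `ℚ`-algebra structure that every field of characteristic zero has. -/
instance (r k : ℕ) [Fact r.Prime] : IsCyclotomicExtension {conductor r k} ℚ (K r k) :=
  CyclotomicField.isCyclotomicExtension (conductor r k) ℚ

/-- The ring of integers `A_{r,k}` of `K r k`. -/
abbrev A (r k : ℕ) : Type := 𝓞 (K r k)

/-- Reduction of `r`-adic integers modulo `𝐫 * r ^ k` (a divisor of `r ^ (k + 2)`). -/
noncomputable def reduction (r k : ℕ) [Fact r.Prime] : ℤ_[r] →+* ZMod (conductor r k) :=
  (ZMod.castHom (conductor_dvd r k) (ZMod (conductor r k))).comp (PadicInt.toZModPow (k + 2))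

/-- The action of `ℤ_r^*`, the Galois group of `ℚ(ζ_{𝐫 r^i} : i ≥ 0)`, on `K r k`: the unit `u`
acts by `ζ ↦ ζ ^ (u mod 𝐫 r^k)`. -/
noncomputable def galAction (r k : ℕ) [Fact r.Prime] : ℤ_[r]ˣ →* Gal(K r k/ℚ) :=
  (IsCyclotomicExtension.Rat.galEquivZMod (conductor r k) (K r k)).symm.toMonoidHom.comp
    (Units.map (reduction r k : ℤ_[r] →* ZMod (conductor r k)))

theorem galAction_apply_root (r k : ℕ) [Fact r.Prime] (u : ℤ_[r]ˣ) {x : K r k}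
    (hx : x ^ conductor r k = 1) :
    galAction r k u x = x ^ (reduction r k (u : ℤ_[r])).val := by
  rw [IsCyclotomicExtension.Rat.galEquivZMod_apply_of_pow_eq (conductor r k) (K r k) _ hx]
  have e : IsCyclotomicExtension.Rat.galEquivZMod (conductor r k) (K r k) (galAction r k u) =
      Units.map (reduction r k : ℤ_[r] →* ZMod (conductor r k)) u :=
    MulEquiv.apply_symm_apply _ _
  rw [e]
  rfl

/-- `Δ_r`, the torsion subgroup of `ℤ_r^*`. -/
noncomputable def Delta (r : ℕ) [Fact r.Prime] : Subgroup ℤ_[r]ˣ := CommGroup.torsion ℤ_[r]ˣ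

/-- `B_{r,k}`, the subring of `A_{r,k}` fixed by `Δ_r`. -/
noncomputable def B (r k : ℕ) [Fact r.Prime] : Subring (A r k) where
  carrier := {a | ∀ δ ∈ Delta r, galAction r k δ (a : K r k) = (a : K r k)}
  mul_mem' {a b} ha hb δ hδ := by simp [ha δ hδ, hb δ hδ]
  one_mem' δ _ := by simp
  add_mem' {a b} ha hb δ hδ := by simp [ha δ hδ, hb δ hδ]
  zero_mem' δ _ := by simp
  neg_mem' {a} ha δ hδ := by simp [ha δ hδ]

/-- The number `l` such that `r ^ l` is the largest power of `r` dividing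
`(p ^ φ(𝐫) - 1) / (𝐫 ^ 2 / r)`. Both divisions are exact for primes `p ≠ r`. -/
def splitExponent (p r : ℕ) : ℕ :=
  padicValNat r ((p ^ Nat.totient (bold r) - 1) / (bold r ^ 2 / r))

/-- `h` is a monic integral polynomial of degree `m` that is irreducible modulo `p`. -/
structure IsBasicIrreducible (p m : ℕ) (h : ℤ[X]) : Prop where
  monic : h.Monic
  natDegree_eq : h.natDegree = m
  irreducible : Irreducible (h.map (Int.castRingHom (ZMod p)))

/-- Such polynomials exist in every positive degree, so every `GR(p ^ n, m)` has a presentation. -/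
theorem exists_isBasicIrreducible (p m : ℕ) [Fact p.Prime] (hm : m ≠ 0) :
    ∃ h : ℤ[X], IsBasicIrreducible p m h := by
  obtain ⟨α, hα⟩ := Field.exists_primitive_element (ZMod p) (GaloisField p m)
  have hint : IsIntegral (ZMod p) α := Algebra.IsIntegral.isIntegral α
  have hdeg : (minpoly (ZMod p) α).natDegree = m := by
    rw [← IntermediateField.adjoin.finrank hint, hα, IntermediateField.finrank_top',
      GaloisField.finrank p hm]
  have hl : minpoly (ZMod p) α ∈ lifts (Int.castRingHom (ZMod p)) :=
    (mem_lifts _).2 (map_surjective _ (ZMod.ringHom_surjective _) _)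
  obtain ⟨h, h1, h2, h3⟩ := lifts_and_natDegree_eq_and_monic hl (minpoly.monic hint)
  exact ⟨h, h3, h2.trans hdeg, h1 ▸ minpoly.irreducible hint⟩

/-- The Galois ring `GR(p ^ n, m) = ℤ[x] / (p ^ n, h)` presented by a monic polynomial `h` of
degree `m` that is irreducible modulo `p`. -/
abbrev GaloisRing (p n : ℕ) (h : ℤ[X]) : Type :=
  ℤ[X] ⧸ Ideal.span ({(p : ℤ[X]) ^ n, h} : Set ℤ[X])

end GaloisModel

namespace GaloisModel

/-! Since `A r k` is generated by a root of unity, `a ^ p ^ t` is congruent modulo `p` to the image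
of `a` under `ζ ↦ ζ ^ p ^ t`. On the `Δ_r`-invariants `B` this map is the identity as soon as `p ^
t` agrees with an element of `Δ_r` modulo the conductor (`natCast_dvd_pow_sub_self`). Conversely, a
residue field of `B` with `p ^ f` elements forces `p ^ f` to agree with such an element
(`exists_mem_Delta_reduction_eq`). So the residue degree at `p` is the order of `p` modulo the
conductor and modulo `Δ_r`.

To compute that order, write `p = δ * x` in `ℤ_r` with `δ` torsion and `x ≡ 1` mod `𝐫`. Lifting the
exponent gives `‖x ^ n - 1‖ = ‖n‖ * ‖x - 1‖`, and `l` is defined so that `‖x - 1‖ = ‖𝐫 * r ^ l‖`.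
Hence the order is `r ^ k` at level `k + l` and `1` at levels `k ≤ l`.

The congruence `x ^ p ^ t ≡ x` mod `p` also shows that `p` generates `P` modulo `P ^ 2`, so no
Dedekind property of `B` is needed: the quotient by `P ^ n` is a finite local ring with maximal
ideal `(p)`, and Hensel lifting of a root of `h` identifies it with the Galois ring. -/

/-! ### Recognizing Galois rings among quotients by prime powers -/

/-- Finite fields of equal cardinality are isomorphic, so `k` is `𝔽_p[x]/(h)`; the root is simple
because `𝔽_p` is perfect. -/
theorem IsBasicIrreducible.exists_aeval_eq_zero {k : Type*} [Field k] [Finite k] {p m : ℕ}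
    [Fact p.Prime] (hk : Nat.card k = p ^ m) {h : ℤ[X]} (hh : IsBasicIrreducible p m h) :
    ∃ α : k, aeval α h = 0 ∧ aeval α (derivative h) ≠ 0 ∧ ∀ x : k, ∃ g : ℤ[X], aeval α g = x := by
  have := Fintype.ofFinite k
  have hk' : Fintype.card k = p ^ m := by rw [← Nat.card_eq_fintype_card, hk]
  have : CharP k p := charP_of_card_eq_prime_pow hk'
  let := ZMod.algebra k p
  let hbar : (ZMod p)[X] := h.map (Int.castRingHom (ZMod p))
  have hirr : Irreducible hbar := hh.irreducible
  have : Fact (Irreducible hbar) := ⟨hirr⟩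
  let pb := AdjoinRoot.powerBasis hirr.ne_zero
  have hfin : Module.Finite (ZMod p) (AdjoinRoot hbar) := pb.finite
  have hcardL : Nat.card (AdjoinRoot hbar) = p ^ m := by
    rw [Module.natCard_eq_pow_finrank (K := ZMod p), pb.finrank, AdjoinRoot.powerBasis_dim,
      hh.monic.natDegree_map, hh.natDegree_eq, Nat.card_zmod]
  have : Finite (AdjoinRoot hbar) := Module.finite_of_finite (ZMod p)
  have := Fintype.ofFinite (AdjoinRoot hbar)
  let e : AdjoinRoot hbar ≃ₐ[ZMod p] k := FiniteField.algEquivOfCardEq p (by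
    rw [← Nat.card_eq_fintype_card, hcardL, hk'])
  have key : ∀ g : ℤ[X], aeval (e (AdjoinRoot.root hbar)) g =
      e (AdjoinRoot.mk hbar (g.map (Int.castRingHom (ZMod p)))) := fun g => by
    rw [← AdjoinRoot.aeval_eq, ← aeval_algHom_apply e]
    exact (aeval_map_algebraMap (R := ℤ) (ZMod p) (e (AdjoinRoot.root hbar)) g).symm
  refine ⟨e (AdjoinRoot.root hbar), ?_, ?_, ?_⟩
  · rw [key, AdjoinRoot.mk_self, map_zero]
  · rw [key, ← derivative_map, ← AdjoinRoot.aeval_eq]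
    intro h0
    rw [map_eq_zero_iff e e.injective] at h0
    refine (PerfectField.separable_of_irreducible hirr).aeval_derivative_ne_zero ?_ h0
    rw [AdjoinRoot.aeval_eq, AdjoinRoot.mk_self]
  · intro x
    obtain ⟨y, rfl⟩ := e.surjective x
    obtain ⟨q, rfl⟩ := AdjoinRoot.mk_surjective y
    obtain ⟨g, rfl⟩ := map_surjective _ (ZMod.ringHom_surjective (Int.castRingHom (ZMod p))) q
    exact ⟨g, key g⟩

/-- A polynomial outside the maximal ideal `(p, h)` is invertible modulo it. -/
theorem IsBasicIrreducible.exists_mul_eq {p m : ℕ} [Fact p.Prime] {h : ℤ[X]}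
    (hh : IsBasicIrreducible p m h) (g : ℤ[X]) :
    (∃ b c : ℤ[X], g = p * b + h * c) ∨ ∃ a b c : ℤ[X], a * g = 1 + p * b + h * c := by
  have hker : ∀ q : ℤ[X], q.map (Int.castRingHom (ZMod p)) = 0 → ∃ b : ℤ[X], q = p * b := by
    intro q hq
    have : (C (p : ℤ)) ∣ q := by
      rw [C_dvd_iff_dvd_coeff]
      intro i
      have := congrArg (fun f => coeff f i) hq
      simpa [ZMod.intCast_zmod_eq_zero_iff_dvd] using this
    simpa [dvd_def] using this
  by_cases hd : h.map (Int.castRingHom (ZMod p)) ∣ g.map (Int.castRingHom (ZMod p))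
  · left
    obtain ⟨c, hc⟩ := hd
    obtain ⟨c, rfl⟩ := map_surjective _ (ZMod.ringHom_surjective (Int.castRingHom (ZMod p))) c
    obtain ⟨b, hb⟩ := hker (g - h * c) (by simp [hc])
    exact ⟨b, c, by linear_combination hb⟩
  · right
    obtain ⟨u, v, huv⟩ := (hh.irreducible.coprime_iff_not_dvd.2 hd).symm
    obtain ⟨u, rfl⟩ := map_surjective _ (ZMod.ringHom_surjective (Int.castRingHom (ZMod p))) u
    obtain ⟨v, rfl⟩ := map_surjective _ (ZMod.ringHom_surjective (Int.castRingHom (ZMod p))) v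
    obtain ⟨b, hb⟩ := hker (u * g + v * h - 1) (by simp [huv])
    exact ⟨u, b, -v, by linear_combination hb⟩

/-- The hypotheses `hP` and `hpn` say that `p` generates the maximal ideal of `R ⧸ P ^ n` and has
nilpotency index at least `n` there. The isomorphism evaluates polynomials at the Hensel lift of a
root of `h`. -/
theorem nonempty_quotient_pow_equiv_galoisRing {R : Type*} [CommRing R] {p m n : ℕ} [Fact p.Prime]
    (hn : n ≠ 0) (P : Ideal R) [P.IsMaximal] (hcard : Nat.card (R ⧸ P) = p ^ m) (hpP : (p : R) ∈ P)
    (hP : P ≤ Ideal.span {(p : R)} ⊔ P ^ n) (hpn : ∀ i < n, (p : R) ^ i ∉ P ^ n)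
    {h : ℤ[X]} (hh : IsBasicIrreducible p m h) :
    Nonempty ((R ⧸ P ^ n) ≃+* GaloisRing p n h) := by
  have : Finite (R ⧸ P) :=
    Nat.finite_of_card_ne_zero (hcard ▸ pow_ne_zero _ (Fact.out : p.Prime).ne_zero)
  obtain ⟨α₀, h0, h0', hsurj₀⟩ : ∃ α : R ⧸ P, aeval α h = 0 ∧ aeval α (derivative h) ≠ 0 ∧
      ∀ x : R ⧸ P, ∃ g : ℤ[X], aeval α g = x := by
    let := Ideal.Quotient.field P
    exact hh.exists_aeval_eq_zero hcard
  let S := R ⧸ P ^ n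
  let π : S →+* R ⧸ P := Ideal.Quotient.factor (Ideal.pow_le_self hn)
  have hπ : ∀ x : R, π (Ideal.Quotient.mk _ x) = Ideal.Quotient.mk P x := fun x => rfl
  have hπp : ∀ s : S, π s = 0 → ∃ s', s = p * s' := by
    intro s hs
    obtain ⟨x, rfl⟩ := Ideal.Quotient.mk_surjective s
    rw [hπ, Ideal.Quotient.eq_zero_iff_mem] at hs
    obtain ⟨y, hy, z, hz, rfl⟩ := Submodule.mem_sup.1 (hP hs)
    obtain ⟨w, rfl⟩ := Ideal.mem_span_singleton'.1 hy
    refine ⟨Ideal.Quotient.mk _ w, ?_⟩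
    rw [map_add, Ideal.Quotient.eq_zero_iff_mem.2 hz, map_mul, map_natCast, add_zero, mul_comm]
  have hpS : (p : S) ^ n = 0 := by
    rw [← map_natCast (Ideal.Quotient.mk (P ^ n)), ← map_pow, Ideal.Quotient.eq_zero_iff_mem]
    exact Ideal.pow_mem_pow hpP n
  have hnil : ∀ s : S, π s = 0 → IsNilpotent s := by
    intro s hs
    obtain ⟨s', rfl⟩ := hπp s hs
    exact ⟨n, by rw [mul_pow, hpS, zero_mul]⟩
  have hπnil : ∀ s : S, IsNilpotent s → π s = 0 := fun s hs => (hs.map π).eq_zero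
  have hunit : ∀ s : S, π s ≠ 0 → IsUnit s := by
    intro s hs
    obtain ⟨t₀, ht₀⟩ := Ideal.Quotient.exists_inv hs
    obtain ⟨t, ht⟩ := Ideal.Quotient.factor_surjective (Ideal.pow_le_self hn) t₀
    have h1 : IsNilpotent (s * t - 1) := hnil _ (by
      have ht' : π t = t₀ := ht
      rw [map_sub, map_mul, ht', ht₀, map_one, sub_self])
    have h2 : IsUnit (s * t) := by simpa using h1.isUnit_add_one
    exact isUnit_of_mul_isUnit_left h2
  have hπaeval : ∀ (s : S) (g : ℤ[X]), π (aeval s g) = aeval (π s) g := fun s g =>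
    (aeval_algHom_apply (π.toIntAlgHom) s g).symm
  obtain ⟨a, ha⟩ := Ideal.Quotient.factor_surjective (Ideal.pow_le_self hn) α₀
  have ha' : π a = α₀ := ha
  obtain ⟨α, ⟨hα1, hα2⟩, -⟩ := existsUnique_nilpotent_sub_and_aeval_eq_zero (P := h) (x := a)
    (hnil _ (by rw [hπaeval, ha', h0])) (hunit _ (by rwa [hπaeval, ha']))
  have hα : π α = α₀ := by
    rw [← ha', eq_comm, ← sub_eq_zero, ← map_sub]; exact hπnil _ hα1
  let φ : ℤ[X] →+* S := (aeval α : ℤ[X] →ₐ[ℤ] S).toRingHom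
  have hφ : ∀ g, φ g = aeval α g := fun g => rfl
  have hφh : φ h = 0 := hα2
  have hφp : φ (p : ℤ[X]) = p := map_natCast φ p
  have hsurj : Function.Surjective φ := by
    have step : ∀ s : S, ∃ g s', s = φ g + p * s' := by
      intro s
      obtain ⟨g, hg⟩ := hsurj₀ (π s)
      obtain ⟨s', hs'⟩ := hπp (s - φ g) (by rw [map_sub, hφ, hπaeval, hα, hg, sub_self])
      exact ⟨g, s', by linear_combination hs'⟩
    -- Successive `p`-adic approximation; at `i = n` the error term vanishes.
    have ind : ∀ (i : ℕ) (s : S), ∃ g s', s = φ g + p ^ i * s' := by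
      intro i
      induction i with
      | zero => exact fun s => ⟨0, s, by simp⟩
      | succ i ih =>
        intro s
        obtain ⟨g, s', hs⟩ := ih s
        obtain ⟨g', s'', hs'⟩ := step s'
        refine ⟨g + p ^ i * g', s'', ?_⟩
        rw [map_add, map_mul, map_pow, hφp, hs, hs']
        ring
    intro s
    obtain ⟨g, s', hs⟩ := ind n s
    exact ⟨g, by rw [hs, hpS, zero_mul, add_zero]⟩
  have hker : RingHom.ker φ = Ideal.span ({(p : ℤ[X]) ^ n, h} : Set ℤ[X]) := by
    apply le_antisymm
    · intro g hg
      rw [RingHom.mem_ker] at hg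
      -- Powers of `p` are split off one at a time: were `b` outside `(p, h)`, its image would be a
      -- unit and `p ^ i` would vanish in `S` with `i < n`.
      have ind : ∀ i ≤ n, ∃ b c : ℤ[X], g = p ^ i * b + h * c := by
        intro i
        induction i with
        | zero => exact fun _ => ⟨g, 0, by simp⟩
        | succ i ih =>
          intro hi
          obtain ⟨b, c, hbc⟩ := ih (by omega)
          rcases hh.exists_mul_eq b with ⟨b', c', rfl⟩ | ⟨u, b', c', hu⟩
          · exact ⟨b', c + p ^ i * c', by rw [hbc]; ring⟩
          · exfalso
            have h1 : (p : S) ^ i * φ b = 0 := by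
              rw [hbc] at hg
              simpa [hφh, hφp] using hg
            have h2 : φ u * φ b = 1 + p * φ b' := by
              rw [← map_mul, hu]; simp [hφh, hφp]
            have h3 : IsUnit (1 + (p : S) * φ b') := by
              refine IsNilpotent.isUnit_one_add ⟨n, ?_⟩
              rw [mul_pow, hpS, zero_mul]
            have h4 : (p : S) ^ i = 0 := by
              rw [← h3.mul_left_eq_zero, ← h2]
              linear_combination φ u * h1
            apply hpn i (by omega)
            rwa [← Ideal.Quotient.eq_zero_iff_mem, map_pow, map_natCast]
      obtain ⟨b, c, hbc⟩ := ind n le_rfl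
      exact Ideal.mem_span_pair.2 ⟨b, c, by rw [hbc]; ring⟩
    · rw [Ideal.span_le]
      rintro x (rfl | rfl)
      · show φ _ = 0
        rw [map_pow, hφp, hpS]
      · exact hφh
  exact ⟨((Ideal.quotEquivOfEq hker.symm).trans
    (RingHom.quotientKerEquivOfSurjective hsurj)).symm⟩

/-! ### Primes above `p` when a power of Frobenius is trivial modulo `p` -/

theorem finite_and_card_le_of_pow_eq_self {k : Type*} [Field k] {p t : ℕ} [Fact p.Prime]
    (hpk : (p : k) = 0) (ht : t ≠ 0) (hk : ∀ x : k, x ^ p ^ t = x) :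
    Finite k ∧ ∃ f ≤ t, Nat.card k = p ^ f := by
  classical
  have hp : p.Prime := Fact.out
  have hq : 1 < p ^ t := Nat.one_lt_pow ht hp.one_lt
  have hroots : ∀ x : k, x ∈ (X ^ p ^ t - X : k[X]).roots.toFinset := by
    intro x
    simp [FiniteField.X_pow_card_sub_X_ne_zero k hq, hk x]
  have hfin : Finite k :=
    Set.finite_univ_iff.1 ((Finset.finite_toSet _).subset fun x _ => hroots x)
  have := Fintype.ofFinite k
  have hle : Nat.card k ≤ p ^ t := by
    rw [Nat.card_eq_fintype_card, ← Finset.card_univ]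
    refine (Finset.card_le_card (t := (X ^ p ^ t - X : k[X]).roots.toFinset)
      fun x _ => hroots x).trans ?_
    refine (Multiset.toFinset_card_le _).trans ((card_roots' _).trans ?_)
    rw [FiniteField.X_pow_card_sub_X_natDegree_eq k hq]
  have hchar : CharP k p := (CharP.charP_iff_prime_eq_zero hp).2 hpk
  obtain ⟨f, -, hf⟩ := FiniteField.card k p
  rw [← Nat.card_eq_fintype_card] at hf
  exact ⟨hfin, f, (Nat.pow_le_pow_iff_right hp.one_lt).1 (hf ▸ hle), hf⟩

/-- A prime `P` containing `p`, in a Noetherian domain on which the `q`-th power map is the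
identity modulo `p`. -/
theorem nonempty_quotient_pow_equiv_galoisRing_of_pow_sub_dvd {R : Type*} [CommRing R] [IsDomain R]
    [IsNoetherianRing R] {p t n : ℕ} [Fact p.Prime] (hp0 : (p : R) ≠ 0) (ht : t ≠ 0)
    (hfrob : ∀ x : R, (p : R) ∣ x ^ p ^ t - x) (hn : n ≠ 0) (P : Ideal R) [P.IsPrime]
    (hpP : (p : R) ∈ P)
    (hmin : ∀ f, Nat.card (R ⧸ P) = p ^ f → t ∣ f)
    {h : ℤ[X]} (hh : IsBasicIrreducible p t h) :
    Nonempty ((R ⧸ P ^ n) ≃+* GaloisRing p n h) := by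
  have hp : p.Prime := Fact.out
  have hq : 1 < p ^ t := Nat.one_lt_pow ht hp.one_lt
  have hfrobQ : ∀ x : R ⧸ P, x ^ p ^ t = x := by
    intro x
    obtain ⟨x, rfl⟩ := Ideal.Quotient.mk_surjective x
    rw [← map_pow, Ideal.Quotient.mk_eq_mk_iff_sub_mem]
    exact P.mem_of_dvd (hfrob x) hpP
  have hF : IsField (R ⧸ P) :=
    { exists_pair_ne := ⟨0, 1, zero_ne_one⟩
      mul_comm := mul_comm
      mul_inv_cancel := fun {x} hx => ⟨x ^ (p ^ t - 2), by
        apply mul_left_cancel₀ hx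
        rw [← pow_succ', ← pow_succ', mul_one]
        convert hfrobQ x using 2
        omega⟩ }
  have hmax : P.IsMaximal := Ideal.Quotient.maximal_of_isField P hF
  obtain ⟨hfin, f, hft', hf⟩ : Finite (R ⧸ P) ∧ ∃ f ≤ t, Nat.card (R ⧸ P) = p ^ f := by
    let := Ideal.Quotient.field P
    refine finite_and_card_le_of_pow_eq_self ?_ ht hfrobQ
    exact (map_natCast (Ideal.Quotient.mk P) p).symm.trans (Ideal.Quotient.eq_zero_iff_mem.2 hpP)
  have hft : f = t := by
    have h1 : 1 < p ^ f := hf ▸ Finite.one_lt_card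
    have h3 : f ≠ 0 := by rintro rfl; simp at h1
    exact le_antisymm hft' (Nat.le_of_dvd (Nat.pos_of_ne_zero h3) (hmin f hf))
  subst hft
  -- Here `x = x ^ q - (x ^ q - x)` with `q = p ^ f ≥ 2`: the first term lies in `P ^ 2`, the second
  -- in `(p)`.
  have hPsq : P ≤ Ideal.span {(p : R)} ⊔ P ^ 2 := by
    intro x hx
    rw [← sub_sub_cancel (x ^ p ^ f) x]
    refine sub_mem (Ideal.mem_sup_right ?_)
      (Ideal.mem_sup_left (Ideal.mem_span_singleton.2 (hfrob x)))
    exact Ideal.pow_le_pow_right hq (Ideal.pow_mem_pow hx _)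
  have hpow : ∀ i, P ^ i ≤ Ideal.span {(p : R) ^ i} ⊔ P ^ (i + 1) := by
    intro i
    induction i with
    | zero => simp
    | succ i ih =>
      have hsp : Ideal.span {(p : R) ^ i} ≤ P ^ i :=
        (Ideal.span_singleton_le_iff_mem _).2 (Ideal.pow_mem_pow hpP i)
      calc P ^ (i + 1) = P ^ i * P := pow_succ P i
        _ ≤ (Ideal.span {(p : R) ^ i} ⊔ P ^ (i + 1)) * P := Ideal.mul_mono_left ih
        _ = Ideal.span {(p : R) ^ i} * P ⊔ P ^ (i + 1 + 1) := by
          rw [Ideal.sup_mul, ← pow_succ]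
        _ ≤ Ideal.span {(p : R) ^ i} * (Ideal.span {(p : R)} ⊔ P ^ 2) ⊔ P ^ (i + 1 + 1) :=
          sup_le_sup_right (Ideal.mul_mono_right hPsq) _
        _ = Ideal.span {(p : R) ^ (i + 1)} ⊔
            Ideal.span {(p : R) ^ i} * P ^ 2 ⊔ P ^ (i + 1 + 1) := by
          rw [Ideal.mul_sup, Ideal.span_singleton_mul_span_singleton, ← pow_succ]
        _ ≤ _ := sup_le (sup_le le_sup_left
          (le_sup_of_le_right ((Ideal.mul_mono_left hsp).trans_eq (pow_add P i 2).symm)))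
          le_sup_right
  have hP2 : ∀ i, P ≤ Ideal.span {(p : R)} ⊔ P ^ (i + 1) := by
    intro i
    induction i with
    | zero => simp
    | succ i ih =>
      refine ih.trans (sup_le le_sup_left ?_)
      calc P ^ (i + 1) = P * P ^ i := pow_succ' P i
        _ ≤ (Ideal.span {(p : R)} ⊔ P ^ 2) * P ^ i := Ideal.mul_mono_left hPsq
        _ = Ideal.span {(p : R)} * P ^ i ⊔ P ^ (i + 1 + 1) := by
          rw [Ideal.sup_mul, ← pow_add]; congr 2; omega
        _ ≤ _ := sup_le_sup_right Ideal.mul_le_left _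
  refine nonempty_quotient_pow_equiv_galoisRing hn P hf hpP ?_ ?_ hh
  · obtain ⟨j, rfl⟩ := Nat.exists_eq_succ_of_ne_zero hn
    exact hP2 j
  · intro i hi hmem
    -- If `p ^ i ∈ P ^ n` with `i < n`, then `P ^ i = P ^ (i + 1)`. Nakayama yields an element
    -- congruent to `1` modulo `P` that kills `p ^ i`; in a domain it is `0`, so `1 ∈ P`.
    have h1 : P ^ i ≤ P • P ^ i := by
      rw [smul_eq_mul, ← pow_succ']
      exact (hpow i).trans (sup_le ((Ideal.span_singleton_le_iff_mem _).2
        (Ideal.pow_le_pow_right hi hmem)) le_rfl)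
    obtain ⟨r, hr, hr0⟩ := Submodule.exists_sub_one_mem_and_smul_eq_zero_of_fg_of_le_smul P (P ^ i)
      (IsNoetherian.noetherian _) h1
    have h2 := hr0 _ (Ideal.pow_mem_pow hpP i)
    rw [smul_eq_mul, mul_eq_zero, or_iff_left (pow_ne_zero i hp0)] at h2
    rw [h2, zero_sub, neg_mem_iff, ← Ideal.eq_top_iff_one] at hr
    exact hmax.ne_top hr

/-! ### Frobenius on `A` and on its `Δ_r`-invariants `B` -/

section

variable (r k : ℕ) [Fact r.Prime]

theorem mem_B_iff {a : A r k} : a ∈ B r k ↔ ∀ δ ∈ Delta r, galAction r k δ • a = a :=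
  forall₂_congr fun _ _ => ⟨fun h => RingOfIntegers.ext h, fun h => congrArg RingOfIntegers.val h⟩

theorem galAction_smul_root (u : ℤ_[r]ˣ) {x : A r k} (hx : x ^ conductor r k = 1) {m : ℕ}
    (hm : reduction r k (u : ℤ_[r]) = m) : galAction r k u • x = x ^ m := by
  have h1 : galAction r k u • x = x ^ (reduction r k (u : ℤ_[r])).val := by
    apply RingOfIntegers.ext
    have hx' : (x : K r k) ^ conductor r k = 1 := by
      rw [← map_pow, hx, map_one]
    exact (galAction_apply_root r k u hx').trans (map_pow _ _ _).symm
  rw [h1, hm, ZMod.val_natCast, ← pow_mod_orderOf,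
    Nat.mod_mod_of_dvd _ (orderOf_dvd_of_pow_eq_one hx),
    pow_mod_orderOf]

theorem exists_root_adjoin_eq_top :
    ∃ ζ : A r k, IsPrimitiveRoot ζ (conductor r k) ∧ Algebra.adjoin ℤ {ζ} = ⊤ := by
  have hζ := IsCyclotomicExtension.zeta_spec (conductor r k) ℚ (K r k)
  refine ⟨hζ.toInteger, hζ.toInteger_isPrimitiveRoot, ?_⟩
  rw [← hζ.integralPowerBasis_gen, PowerBasis.adjoin_gen_eq_top]

/-- Both maps are ring homomorphisms modulo `p`, and they agree on the generator `ζ` of `A`. -/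
theorem natCast_dvd_pow_sub_galAction_smul {p t : ℕ} [Fact p.Prime] {u : ℤ_[r]ˣ}
    (hu : reduction r k (u : ℤ_[r]) = (p ^ t : ℕ)) (a : A r k) :
    (p : A r k) ∣ a ^ p ^ t - galAction r k u • a := by
  obtain ⟨ζ, hζ, htop⟩ := exists_root_adjoin_eq_top r k
  have ha : a ∈ Algebra.adjoin ℤ {ζ} := htop ▸ Algebra.mem_top
  induction ha using Algebra.adjoin_induction with
  | mem x hx =>
    rw [Set.mem_singleton_iff.1 hx, galAction_smul_root r k u hζ.pow_eq_one hu, sub_self]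
    exact dvd_zero _
  | algebraMap z =>
    have h1 : galAction r k u • (z : A r k) = z := map_intCast (MulSemiringAction.toRingHom _ _ _) z
    rw [eq_intCast, h1, ← Int.cast_pow, ← Int.cast_sub]
    have h2 : (p : ℤ) ∣ z ^ p ^ t - z := by
      rw [← ZMod.intCast_zmod_eq_zero_iff_dvd]
      push_cast
      rw [ZMod.pow_card_pow, sub_self]
    obtain ⟨w, hw⟩ := h2
    exact ⟨w, by rw [hw]; push_cast; ring⟩
  | add x y _ _ hx hy =>
    obtain ⟨s, hs⟩ := exists_add_pow_prime_pow_eq (Fact.out : p.Prime) x y t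
    obtain ⟨x', hx⟩ := hx
    obtain ⟨y', hy⟩ := hy
    refine ⟨x' + y' + x * y * s, ?_⟩
    rw [hs, smul_add]
    linear_combination hx + hy
  | mul x y _ _ hx hy =>
    obtain ⟨x', hx⟩ := hx
    obtain ⟨y', hy⟩ := hy
    refine ⟨x' * y ^ p ^ t + (galAction r k u • x) * y', ?_⟩
    rw [mul_pow, smul_mul']
    linear_combination hx * y ^ p ^ t + (galAction r k u • x) * hy

theorem natCast_dvd_pow_sub_self {p t : ℕ} [Fact p.Prime] {δ : ℤ_[r]ˣ} (hδ : δ ∈ Delta r)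
    (hu : reduction r k (δ : ℤ_[r]) = (p ^ t : ℕ)) (b : B r k) :
    (p : B r k) ∣ b ^ p ^ t - b := by
  obtain ⟨c, hc⟩ := natCast_dvd_pow_sub_galAction_smul r k hu (b : A r k)
  rw [(mem_B_iff r k).1 b.2 δ hδ] at hc
  have hp0 : (p : A r k) ≠ 0 := Nat.cast_ne_zero.2 (Fact.out : p.Prime).ne_zero
  -- Divisibility by `p` descends from `A` to `B`: the quotient is invariant because `p * c` is and
  -- `p` can be cancelled.
  have hcB : c ∈ B r k := by
    rw [mem_B_iff]
    intro ε hε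
    apply mul_left_cancel₀ hp0
    have h1 : galAction r k ε • ((p : A r k) * c) = p * c := by
      rw [← hc]
      exact (mem_B_iff r k).1 (sub_mem (pow_mem b.2 _) b.2) ε hε
    rwa [smul_mul', show galAction r k ε • (p : A r k) = p from
      map_natCast (MulSemiringAction.toRingHom _ _ _) p] at h1
  exact ⟨⟨c, hcB⟩, Subtype.ext hc⟩

instance : IsNoetherianRing (B r k) := by
  have h1 : IsNoetherian ℤ (B r k) :=
    isNoetherian_of_injective ((B r k).subtype.toIntAlgHom.toLinearMap) Subtype.val_injective
  exact isNoetherian_of_tower ℤ h1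

instance : Algebra.IsIntegral (B r k) (A r k) := Algebra.IsIntegral.tower_top ℤ

/-- The polynomial `∏ (X - g ζ)` over the image of `Δ_r` has coefficients in `B`. Modulo a prime `Q`
above `P` they are fixed by the `p ^ f`-th power map, so `ζ ^ p ^ f` is again a root and equals some
`g ζ` modulo `Q`. As `p` does not divide the conductor, `ζ` keeps its order modulo `Q`, and the
exponents can be compared. -/
theorem exists_mem_Delta_reduction_eq {p f : ℕ} [Fact p.Prime] (hrp : r ≠ p)
    (P : Ideal (B r k)) [P.IsPrime] (hpP : (p : B r k) ∈ P)
    (hcard : Nat.card (B r k ⧸ P) = p ^ f) :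
    ∃ δ ∈ Delta r, reduction r k (δ : ℤ_[r]) = (p ^ f : ℕ) := by
  have hfin : Finite (B r k ⧸ P) :=
    Nat.finite_of_card_ne_zero (hcard ▸ pow_ne_zero _ (Fact.out : p.Prime).ne_zero)
  obtain ⟨ζ, hζ, -⟩ := exists_root_adjoin_eq_top r k
  obtain ⟨Q, -, hQ, hQP⟩ := Ideal.exists_ideal_over_prime_of_isIntegral (S := A r k) P ⊥ (by
    rw [← RingHom.ker_eq_comap_bot, (RingHom.injective_iff_ker_eq_bot _).1]
    · exact bot_le
    · exact Subtype.val_injective)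
  let π := Ideal.Quotient.mk Q
  have hpQ : π p = 0 := by
    rw [Ideal.Quotient.eq_zero_iff_mem]
    have : (p : B r k) ∈ Q.comap (algebraMap (B r k) (A r k)) := hQP ▸ hpP
    simpa using this
  have hchar : CharP (A r k ⧸ Q) p :=
    (CharP.charP_iff_prime_eq_zero Fact.out).2 (by rw [← hpQ, map_natCast])
  have hcop : ¬ p ∣ conductor r k := fun h =>
    hrp (((Nat.prime_dvd_prime_iff_eq Fact.out Fact.out).1
      ((Fact.out : p.Prime).dvd_of_dvd_pow (h.trans (conductor_dvd r k)))).symm)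
  have : NeZero (conductor r k : A r k ⧸ Q) := ⟨by rwa [Ne, CharP.cast_eq_zero_iff _ p]⟩
  have hζ' : IsPrimitiveRoot (π ζ) (conductor r k) := by
    rw [← isRoot_cyclotomic_iff, ← map_cyclotomic _ π]
    exact (hζ.isRoot_cyclotomic (NeZero.pos _)).map
  let G : Subgroup Gal(K r k/ℚ) := (Delta r).map (galAction r k)
  have := Fintype.ofFinite G
  let F : (A r k)[X] := MulSemiringAction.charpoly G ζ
  have hpow : ∀ b : B r k, π (b : A r k) ^ p ^ f = π b := by
    intro b
    have h1 : (Ideal.Quotient.mk P b) ^ p ^ f = Ideal.Quotient.mk P b := by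
      let hfield : IsField (B r k ⧸ P) := Finite.isField_of_domain _
      let := hfield.toField
      have := Fintype.ofFinite (B r k ⧸ P)
      rw [← hcard, Nat.card_eq_fintype_card]
      exact FiniteField.pow_card _
    rw [← map_pow, Ideal.Quotient.mk_eq_mk_iff_sub_mem, ← hQP] at h1
    rw [← map_pow, Ideal.Quotient.mk_eq_mk_iff_sub_mem]
    exact h1
  have hcoeff : ∀ i, π (F.coeff i) ^ p ^ f = π (F.coeff i) := by
    intro i
    refine hpow ⟨F.coeff i, (mem_B_iff r k).2 fun δ hδ => ?_⟩
    exact MulSemiringAction.smul_coeff_charpoly ζ i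
      (⟨galAction r k δ, Subgroup.mem_map_of_mem _ hδ⟩ : G)
  have hroot : eval (π ζ ^ p ^ f) (F.map π) = 0 := by
    have h1 : (F.map π).map (iterateFrobenius (A r k ⧸ Q) p f) = F.map π := by
      ext i
      simp only [coeff_map, iterateFrobenius_def]
      exact hcoeff i
    have h2 : eval (π ζ) (F.map π) = 0 := by
      rw [eval_map_apply, MulSemiringAction.eval_charpoly, map_zero]
    rw [← iterateFrobenius_def, ← h1, eval_map_apply, h2, map_zero]
  rw [show F = ∏ g : G, (X - C (g • ζ)) from rfl, Polynomial.map_prod,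
    eval_prod, Finset.prod_eq_zero_iff] at hroot
  obtain ⟨⟨g, δ, hδ, rfl⟩, -, hg⟩ := hroot
  refine ⟨δ, hδ, ?_⟩
  rw [Polynomial.map_sub, map_X, map_C, eval_sub, eval_X, eval_C, sub_eq_zero] at hg
  have h3 : galAction r k δ • ζ = ζ ^ (reduction r k (δ : ℤ_[r])).val :=
    galAction_smul_root r k δ hζ.pow_eq_one (by rw [ZMod.natCast_zmod_val])
  have h4 : π ζ ^ p ^ f = π ζ ^ (reduction r k (δ : ℤ_[r])).val := by
    rw [← map_pow π ζ (reduction r k (δ : ℤ_[r])).val, ← h3]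
    exact hg
  rw [← ZMod.natCast_zmod_val (reduction r k (δ : ℤ_[r])), eq_comm, ZMod.natCast_eq_natCast_iff]
  have hunit := (IsPrimitiveRoot.isUnit_unit (NeZero.ne _) hζ').eq_orderOf
  have h5 : (hζ'.isUnit (NeZero.ne _)).unit ^ p ^ f =
      (hζ'.isUnit (NeZero.ne _)).unit ^ (reduction r k (δ : ℤ_[r])).val := Units.ext h4
  have h6 := pow_eq_pow_iff_modEq.1 h5
  rwa [← hunit] at h6

end

/-! ### Lifting the exponent in `ℤ_r` -/

section

theorem dvd_bold (r : ℕ) : r ∣ bold r := Dvd.intro _ rfl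

variable (r : ℕ) [hr : Fact r.Prime]

theorem reduction_eq_zero_iff (k : ℕ) (x : ℤ_[r]) :
    reduction r k x = 0 ↔ (conductor r k : ℤ_[r]) ∣ x := by
  constructor
  · intro h
    have h1 : (r : ℤ_[r]) ^ (k + 2) ∣ x - x.appr (k + 2) :=
      Ideal.mem_span_singleton.1 (PadicInt.appr_spec (k + 2) x)
    have h2 : (conductor r k : ℤ_[r]) ∣ x - x.appr (k + 2) := by
      refine dvd_trans ?_ h1
      exact_mod_cast Nat.cast_dvd_cast (α := ℤ_[r]) (conductor_dvd r k)
    have h3 : reduction r k (x.appr (k + 2) : ℕ) = 0 := by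
      obtain ⟨y, hy⟩ := h2
      rw [← sub_sub_cancel x (x.appr (k + 2) : ℤ_[r]), hy, map_sub, map_mul, h, map_natCast,
        ZMod.natCast_self, zero_mul, sub_zero]
    rw [map_natCast, ZMod.natCast_eq_zero_iff] at h3
    rw [dvd_iff_dvd_of_dvd_sub h2]
    exact Nat.cast_dvd_cast h3
  · rintro ⟨y, rfl⟩
    rw [map_mul, map_natCast, ZMod.natCast_self, zero_mul]

theorem bold_eq : bold r = if r = 2 then 4 else r := by
  unfold bold
  split_ifs with h
  · subst h; rfl
  · rw [((Nat.coprime_primes hr.out Nat.prime_two).2 h), mul_one]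

theorem norm_eq_one_iff_not_dvd {x : ℤ_[r]} : ‖x‖ = 1 ↔ ¬ (r : ℤ_[r]) ∣ x := by
  rw [← PadicInt.norm_lt_one_iff_dvd, not_lt]
  exact ⟨fun h => h.ge, fun h => le_antisymm (PadicInt.norm_le_one x) h⟩

theorem natCast_dvd_natCast_iff {n : ℕ} : (r : ℤ_[r]) ∣ n ↔ r ∣ n := by
  rw [← PadicInt.norm_lt_one_iff_dvd]
  exact_mod_cast PadicInt.norm_int_lt_one_iff_dvd (p := r) n

theorem dvd_of_norm_le {x y : ℤ_[r]} (h : ‖x‖ ≤ ‖y‖) : y ∣ x := by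
  rcases eq_or_ne y 0 with rfl | hy
  · rw [norm_zero, norm_le_zero_iff] at h
    rw [h]
  have hy' : (y : ℚ_[r]) ≠ 0 := PadicInt.coe_ne_zero.2 hy
  have hxy : ‖(x / y : ℚ_[r])‖ ≤ 1 := by
    rw [norm_div]
    exact div_le_one_of_le₀ h (norm_nonneg _)
  refine ⟨⟨x / y, hxy⟩, PadicInt.ext ?_⟩
  exact (mul_div_cancel₀ _ hy').symm

theorem norm_le_of_dvd {x y : ℤ_[r]} (h : y ∣ x) : ‖x‖ ≤ ‖y‖ := by
  obtain ⟨z, rfl⟩ := h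
  rw [norm_mul]
  exact mul_le_of_le_one_right (norm_nonneg _) (PadicInt.norm_le_one z)

theorem norm_geom_sum_of_bold_dvd {x : ℤ_[r]} (hx : (bold r : ℤ_[r]) ∣ x - 1) :
    ‖∑ i ∈ Finset.range r, x ^ i‖ = ‖(r : ℤ_[r])‖ := by
  -- For `r = 2` the difference is `x - 1`, so congruence modulo `4` is needed; this is why `𝐫 = 4`
  -- there.
  have key : (r : ℤ_[r]) ^ 2 ∣ ∑ i ∈ Finset.range r, x ^ i - r := by
    rcases eq_or_ne r 2 with rfl | h2
    · have h4 : (bold 2 : ℤ_[2]) = (2 : ℤ_[2]) ^ 2 := by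
        rw [bold_eq]; norm_num
      rw [h4] at hx
      have h5 : ∑ i ∈ Finset.range 2, x ^ i - (2 : ℕ) = x - 1 := by
        rw [Finset.sum_range_succ, Finset.sum_range_one]; push_cast; ring
      rw [h5]
      exact_mod_cast hx
    · have hodd : Odd r := hr.out.odd_of_ne_two h2
      obtain ⟨b, hb⟩ := (Nat.cast_dvd_cast (dvd_bold r)).trans hx
      rw [show x = 1 + r * b by rw [← hb]; ring]
      simpa using odd_sq_dvd_geom_sum₂_sub (1 : ℤ_[r]) b hodd
  obtain ⟨y, hy⟩ := key
  have h1 : ∑ i ∈ Finset.range r, x ^ i = r * (1 + r * y) := by linear_combination hy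
  have h2 : ‖1 + r * y‖ = 1 := by
    rw [norm_eq_one_iff_not_dvd, dvd_add_left (dvd_mul_right _ _)]
    exact PadicInt.prime_p.not_dvd_one
  rw [h1, norm_mul, h2, mul_one]

/-- The formula is multiplicative in `n`, since `x ^ a ≡ 1` mod `𝐫` as well, which leaves prime
exponents. For a prime `q ≠ r` the geometric sum is `≡ q` mod `r`, a unit. -/
theorem norm_pow_sub_one {x : ℤ_[r]} (hx : (bold r : ℤ_[r]) ∣ x - 1) (n : ℕ) :
    ‖x ^ n - 1‖ = ‖(n : ℤ_[r])‖ * ‖x - 1‖ := by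
  rcases eq_or_ne n 0 with rfl | hn
  · simp
  induction n using Nat.recOnMul generalizing x with
  | zero => simp at hn
  | one => simp
  | prime q hq =>
    rw [← geom_sum_mul, norm_mul]
    congr 1
    rcases eq_or_ne q r with rfl | hqr
    · exact norm_geom_sum_of_bold_dvd q hx
    · rw [norm_eq_one_iff_not_dvd _ |>.2, norm_eq_one_iff_not_dvd _ |>.2]
      · rw [natCast_dvd_natCast_iff, Nat.prime_dvd_prime_iff_eq hr.out hq]
        exact hqr.symm
      · have h1 : (r : ℤ_[r]) ∣ ∑ i ∈ Finset.range q, x ^ i - q := by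
          have h2 : ∑ i ∈ Finset.range q, x ^ i - q = ∑ i ∈ Finset.range q, (x ^ i - 1) := by
            simp
          rw [h2]
          exact Finset.dvd_sum fun i _ =>
            ((Nat.cast_dvd_cast (dvd_bold r)).trans hx).trans (sub_one_dvd_pow_sub_one x i)
        rw [dvd_iff_dvd_of_dvd_sub h1, natCast_dvd_natCast_iff,
          Nat.prime_dvd_prime_iff_eq hr.out hq]
        exact hqr.symm
  | mul a b iha ihb =>
    rw [mul_ne_zero_iff] at hn
    have hxa : (bold r : ℤ_[r]) ∣ x ^ a - 1 := hx.trans (sub_one_dvd_pow_sub_one _ _)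
    rw [pow_mul, ihb hxa hn.2, iha hx hn.1, Nat.cast_mul, norm_mul]
    ring

theorem eq_one_of_mem_Delta {ε : ℤ_[r]ˣ} (hε : ε ∈ Delta r)
    (h : (bold r : ℤ_[r]) ∣ (ε : ℤ_[r]) - 1) : (ε : ℤ_[r]) = 1 := by
  obtain ⟨m, hm, hεm⟩ := isOfFinOrder_iff_pow_eq_one.1 hε
  have h1 := norm_pow_sub_one r h m
  rw [← Units.val_pow_eq_pow_val, hεm, Units.val_one, sub_self, norm_zero, eq_comm, mul_eq_zero,
    norm_eq_zero, norm_eq_zero, Nat.cast_eq_zero, or_iff_right hm.ne', sub_eq_zero] at h1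
  exact h1

/-! ### The decomposition of `p` into a torsion unit and a unit congruent to `1` -/

variable {p : ℕ} [hp : Fact p.Prime]

/-- The Teichmüller representative of `p`. -/
theorem exists_mem_Delta_bold_dvd (hrp : r ≠ p) :
    ∃ δ ∈ Delta r, (δ : ℤ_[r]) ^ (bold r).totient = 1 ∧ (bold r : ℤ_[r]) ∣ p - (δ : ℤ_[r]) := by
  rw [bold_eq]
  split_ifs with h2
  · subst h2
    have hodd : p % 2 = 1 := hp.out.eq_two_or_odd.resolve_left hrp.symm
    have htot : Nat.totient 4 = 2 := rfl
    rw [htot]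
    rcases (show p % 4 = 1 ∨ p % 4 = 3 by omega) with h4 | h4
    · refine ⟨1, one_mem _, by simp, ?_⟩
      obtain ⟨c, hc⟩ : ∃ c, p = 4 * c + 1 := ⟨p / 4, by omega⟩
      exact ⟨c, by rw [hc]; push_cast; ring⟩
    · refine ⟨-1, isOfFinOrder_iff_pow_eq_one.2 ⟨2, two_pos, by simp⟩, by simp, ?_⟩
      obtain ⟨c, hc⟩ : ∃ c, p = 4 * c + 3 := ⟨p / 4, by omega⟩
      exact ⟨c + 1, by rw [hc]; push_cast; ring⟩
  · have hpr : ¬ r ∣ p := by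
      rw [Nat.prime_dvd_prime_iff_eq hr.out hp.out]; exact hrp
    have hr2 : 2 ≤ r := hr.out.two_le
    rw [Nat.totient_prime hr.out]
    -- By Fermat, `p` is a root of `F` modulo `r`, and it is simple; Hensel's lemma lifts it to a
    -- root of unity.
    let F : ℤ_[r][X] := X ^ (r - 1) - 1
    have hF : ∀ a : ℤ_[r], aeval a F = a ^ (r - 1) - 1 := fun a => by simp [F]
    have hF' : ‖aeval (p : ℤ_[r]) (derivative F)‖ = 1 := by
      have h1 : aeval (p : ℤ_[r]) (derivative F) = ((r - 1 : ℕ) * p ^ (r - 1 - 1) : ℕ) := by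
        simp [F, derivative_X_pow]
      rw [h1, norm_eq_one_iff_not_dvd, natCast_dvd_natCast_iff, hr.out.dvd_mul, not_or]
      refine ⟨fun h => ?_, fun h => hpr (hr.out.dvd_of_dvd_pow h)⟩
      have := Nat.le_of_dvd (by omega) h
      omega
    have hFp : ‖aeval (p : ℤ_[r]) F‖ < 1 := by
      rw [hF, PadicInt.norm_lt_one_iff_dvd]
      have h1 : ((p : ℤ) ^ (r - 1)) ≡ 1 [ZMOD r] :=
        Int.ModEq.pow_card_sub_one_eq_one hr.out
          ((Nat.isCoprime_iff_coprime).2 ((Nat.coprime_primes hp.out hr.out).2 hrp.symm))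
      obtain ⟨c, hc⟩ := h1.symm.dvd
      refine ⟨c, ?_⟩
      exact_mod_cast congrArg (Int.cast : ℤ → ℤ_[r]) hc
    obtain ⟨z, hz0, hz1, -⟩ := hensels_lemma (F := F) (a := (p : ℤ_[r]))
      (by rwa [hF', one_pow])
    rw [hF, sub_eq_zero] at hz0
    rw [hF', PadicInt.norm_lt_one_iff_dvd] at hz1
    refine ⟨Units.ofPowEqOne z (r - 1) hz0 (by omega), ?_, hz0, ?_⟩
    · exact isOfFinOrder_iff_pow_eq_one.2 ⟨r - 1, by omega, Units.ext hz0⟩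
    · exact (dvd_sub_comm).1 hz1

theorem bold_sq_div_dvd (hrp : r ≠ p) : bold r ^ 2 / r ∣ p ^ (bold r).totient - 1 := by
  rw [bold_eq]
  split_ifs with h2
  · subst h2
    exact Nat.eight_dvd_sq_sub_one_of_odd (hp.out.odd_of_ne_two hrp.symm)
  · rw [sq, Nat.mul_div_cancel _ hr.out.pos]
    exact (Nat.modEq_iff_dvd' (Nat.one_le_pow _ _ hp.out.pos)).1
      (Nat.ModEq.pow_totient ((Nat.coprime_primes hp.out hr.out).2 hrp.symm)).symm

theorem norm_totient_mul_norm_bold :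
    ‖((bold r).totient : ℤ_[r])‖ * ‖(bold r : ℤ_[r])‖ = ‖((bold r ^ 2 / r : ℕ) : ℤ_[r])‖ := by
  rw [bold_eq]
  split_ifs with h2
  · subst h2
    rw [← norm_mul, ← Nat.cast_mul]
    rfl
  · have hr2 : 2 ≤ r := hr.out.two_le
    rw [sq, Nat.mul_div_cancel _ hr.out.pos, Nat.totient_prime hr.out,
      (norm_eq_one_iff_not_dvd r).2, one_mul]
    rw [natCast_dvd_natCast_iff]
    intro h
    have := Nat.le_of_dvd (by omega) h
    omega

theorem norm_natCast_eq (n : ℕ) (hn : n ≠ 0) :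
    ‖(n : ℤ_[r])‖ = ‖(r : ℤ_[r])‖ ^ padicValNat r n := by
  obtain ⟨u, hu⟩ := pow_padicValNat_dvd (p := r) (n := n)
  have hru : ¬ r ∣ u := by
    rintro ⟨w, rfl⟩
    exact pow_succ_padicValNat_not_dvd (p := r) hn ⟨w, by rw [pow_succ, mul_assoc, ← hu]⟩
  have h1 : (n : ℤ_[r]) = r ^ padicValNat r n * u := by
    exact_mod_cast congrArg (Nat.cast : ℕ → ℤ_[r]) hu
  rw [h1, norm_mul, norm_pow, (norm_eq_one_iff_not_dvd r (x := u)).2, mul_one]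
  rwa [natCast_dvd_natCast_iff]

/-- As `δ ^ φ(𝐫) = 1`, the numbers `p` and `x` have the same `φ(𝐫)`-th power, so `‖p ^ φ(𝐫) - 1‖ =
‖φ(𝐫)‖ * ‖x - 1‖`. The denominator `𝐫 ^ 2 / r` has the norm of `φ(𝐫) * 𝐫`, which turns the
definition of `l` into the norm of `x - 1`. -/
theorem exists_eq_Delta_mul (hrp : r ≠ p) :
    ∃ δ ∈ Delta r, ∃ x : ℤ_[r], (p : ℤ_[r]) = δ * x ∧ (bold r : ℤ_[r]) ∣ x - 1 ∧
      ‖x - 1‖ = ‖(bold r : ℤ_[r])‖ * ‖(r : ℤ_[r])‖ ^ splitExponent p r := by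
  obtain ⟨δ, hδ, hδ1, hδp⟩ := exists_mem_Delta_bold_dvd r hrp
  have hx : (bold r : ℤ_[r]) ∣ ((δ⁻¹ : ℤ_[r]ˣ) : ℤ_[r]) * p - 1 := by
    have h1 := hδp.mul_left ((δ⁻¹ : ℤ_[r]ˣ) : ℤ_[r])
    rwa [mul_sub, Units.inv_mul] at h1
  refine ⟨δ, hδ, (δ⁻¹ : ℤ_[r]ˣ) * p, (Units.mul_inv_cancel_left _ _).symm, hx, ?_⟩
  have htot : 0 < (bold r).totient :=
    Nat.totient_pos.2 (Nat.pos_of_ne_zero (left_ne_zero_of_mul (conductor_ne_zero r 0)))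
  have h1 := norm_pow_sub_one r hx (bold r).totient
  have h2 : (((δ⁻¹ : ℤ_[r]ˣ) : ℤ_[r]) * p) ^ (bold r).totient = p ^ (bold r).totient := by
    have h3 : ((δ⁻¹ : ℤ_[r]ˣ) : ℤ_[r]) ^ (bold r).totient = 1 := by
      have h4 : δ ^ (bold r).totient = 1 := Units.ext hδ1
      rw [← Units.val_pow_eq_pow_val, inv_pow, h4, inv_one, Units.val_one]
    rw [mul_pow, h3, one_mul]
  have hpos : 1 < p ^ (bold r).totient := Nat.one_lt_pow htot.ne' hp.out.one_lt
  have h3 : (p : ℤ_[r]) ^ (bold r).totient - 1 = (bold r ^ 2 / r : ℕ) *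
      ((p ^ (bold r).totient - 1) / (bold r ^ 2 / r) : ℕ) := by
    rw [← Nat.cast_mul, Nat.mul_div_cancel' (bold_sq_div_dvd r hrp), Nat.cast_sub hpos.le]
    push_cast
    ring
  have hquot : (p ^ (bold r).totient - 1) / (bold r ^ 2 / r) ≠ 0 := by
    intro h0
    have h4 := Nat.div_mul_cancel (bold_sq_div_dvd r hrp)
    rw [h0] at h4
    omega
  rw [h2, h3, norm_mul, norm_natCast_eq r _ hquot, ← norm_totient_mul_norm_bold,
    mul_assoc] at h1
  exact (mul_left_cancel₀ (norm_ne_zero_iff.2 (Nat.cast_ne_zero.2 htot.ne')) h1).symm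

theorem norm_conductor (k : ℕ) :
    ‖(conductor r k : ℤ_[r])‖ = ‖(bold r : ℤ_[r])‖ * ‖(r : ℤ_[r])‖ ^ k := by
  rw [conductor, Nat.cast_mul, Nat.cast_pow, norm_mul, norm_pow]

theorem reduction_eq_of_norm_le {k : ℕ} {x y : ℤ_[r]} (h : ‖x - y‖ ≤ ‖(conductor r k : ℤ_[r])‖) :
    reduction r k x = reduction r k y := by
  rw [← sub_eq_zero, ← map_sub, reduction_eq_zero_iff]
  exact dvd_of_norm_le r h

theorem exists_mem_Delta_reduction_eq_pow (hrp : r ≠ p) (k : ℕ) :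
    ∃ δ ∈ Delta r, reduction r (k + splitExponent p r) (δ : ℤ_[r]) = (p ^ r ^ k : ℕ) := by
  obtain ⟨δ, hδ, x, hpx, hx, hnorm⟩ := exists_eq_Delta_mul r hrp
  refine ⟨δ ^ r ^ k, pow_mem hδ _, ?_⟩
  rw [← map_natCast (reduction r (k + splitExponent p r)), eq_comm]
  apply reduction_eq_of_norm_le
  rw [Nat.cast_pow, hpx, Units.val_pow_eq_pow_val, mul_pow, ← mul_sub_one, norm_mul,
    norm_pow, PadicInt.norm_units, one_pow, one_mul, norm_pow_sub_one r hx, hnorm,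
    norm_conductor, Nat.cast_pow, norm_pow, pow_add]
  exact le_of_eq (by ring)

theorem exists_mem_Delta_reduction_eq_self (hrp : r ≠ p) {k : ℕ} (hk : k ≤ splitExponent p r) :
    ∃ δ ∈ Delta r, reduction r k (δ : ℤ_[r]) = p := by
  obtain ⟨δ, hδ, x, hpx, hx, hnorm⟩ := exists_eq_Delta_mul r hrp
  refine ⟨δ, hδ, ?_⟩
  rw [← map_natCast (reduction r k), eq_comm]
  apply reduction_eq_of_norm_le
  rw [hpx, ← mul_sub_one, norm_mul, PadicInt.norm_units, one_mul, hnorm, norm_conductor]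
  exact mul_le_mul_of_nonneg_left
    (pow_le_pow_of_le_one (norm_nonneg _) (PadicInt.norm_le_one _) hk) (norm_nonneg _)

/-- Modulo the conductor, `x ^ f` agrees with the torsion unit `ε = δ⁻ᶠ δ'`. Then `ε ≡ 1` mod `𝐫`,
so `ε = 1`, and the norm of `x ^ f - 1` gives `‖f‖ ≤ ‖r‖ ^ k`. -/
theorem pow_dvd_of_reduction_eq_pow (hrp : r ≠ p) {k f : ℕ} {δ' : ℤ_[r]ˣ} (hδ' : δ' ∈ Delta r)
    (h : reduction r (k + splitExponent p r) (δ' : ℤ_[r]) = (p ^ f : ℕ)) : r ^ k ∣ f := by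
  obtain ⟨δ, hδ, x, hpx, hx, hnorm⟩ := exists_eq_Delta_mul r hrp
  let ε : ℤ_[r]ˣ := (δ ^ f)⁻¹ * δ'
  have hε : ε ∈ Delta r := mul_mem (inv_mem (pow_mem hδ f)) hδ'
  have hdvd : (conductor r (k + splitExponent p r) : ℤ_[r]) ∣ x ^ f - ε := by
    rw [← map_natCast (reduction r (k + splitExponent p r)), eq_comm, ← sub_eq_zero, ← map_sub,
      reduction_eq_zero_iff, Nat.cast_pow, hpx, mul_pow] at h
    have h1 := h.mul_left (((δ ^ f)⁻¹ : ℤ_[r]ˣ) : ℤ_[r])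
    rwa [mul_sub, ← Units.val_pow_eq_pow_val, Units.inv_mul_cancel_left, ← Units.val_mul] at h1
  have hbold : (bold r : ℤ_[r]) ∣ (ε : ℤ_[r]) - 1 := by
    have h1 : (bold r : ℤ_[r]) ∣ x ^ f - ε :=
      (Nat.cast_dvd_cast (Dvd.intro _ rfl : bold r ∣ conductor r _)).trans hdvd
    have h2 : (bold r : ℤ_[r]) ∣ x ^ f - 1 := hx.trans (sub_one_dvd_pow_sub_one x f)
    simpa using dvd_sub h2 h1
  rw [eq_one_of_mem_Delta r hε hbold] at hdvd
  have h1 := norm_le_of_dvd r hdvd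
  rw [norm_pow_sub_one r hx, hnorm, norm_conductor, pow_add] at h1
  have hr0 : 0 < ‖(r : ℤ_[r])‖ := norm_pos_iff.2 (Nat.cast_ne_zero.2 hr.out.ne_zero)
  have hb0 : 0 < ‖(bold r : ℤ_[r])‖ :=
    norm_pos_iff.2 (Nat.cast_ne_zero.2 (left_ne_zero_of_mul (conductor_ne_zero r 0)))
  have h2 : ‖(f : ℤ_[r])‖ ≤ ‖(r : ℤ_[r])‖ ^ k := by
    refine le_of_mul_le_mul_right ?_ (mul_pos hb0 (pow_pos hr0 (splitExponent p r)))
    linarith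
  have h3 := PadicInt.norm_int_le_pow_iff_dvd (p := r) (k := f) (n := k)
  rw [PadicInt.norm_p, inv_pow, ← zpow_natCast, ← zpow_neg] at h2
  exact_mod_cast h3.1 (by exact_mod_cast h2)

end

end GaloisModel

/-! ### The proposition, with residue degrees `r ^ k` and `1` -/

theorem mainTheorem1 (p r : ℕ) [Fact p.Prime] [Fact r.Prime] (hrp : r ≠ p)
    (k n : ℕ) (hn : 1 ≤ n) :
    (∀ 𝔭 : Ideal (GaloisModel.B r (k + GaloisModel.splitExponent p r)), 𝔭.IsPrime →
      (p : GaloisModel.B r (k + GaloisModel.splitExponent p r)) ∈ 𝔭 →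
      ∀ h : Polynomial ℤ, GaloisModel.IsBasicIrreducible p (r ^ k) h →
        Nonempty ((GaloisModel.B r (k + GaloisModel.splitExponent p r) ⧸ 𝔭 ^ n) ≃+*
          GaloisModel.GaloisRing p n h)) ∧
    (k ≤ GaloisModel.splitExponent p r →
      ∀ 𝔭 : Ideal (GaloisModel.B r k), 𝔭.IsPrime → (p : GaloisModel.B r k) ∈ 𝔭 →
      ∀ h : Polynomial ℤ, GaloisModel.IsBasicIrreducible p 1 h →
        Nonempty ((GaloisModel.B r k ⧸ 𝔭 ^ n) ≃+* GaloisModel.GaloisRing p n h)) := by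
  have hp0 : ∀ j, (p : GaloisModel.B r j) ≠ 0 := fun j =>
    Nat.cast_ne_zero.2 (Fact.out : p.Prime).ne_zero
  have hn0 : n ≠ 0 := Nat.one_le_iff_ne_zero.1 hn
  refine ⟨fun P hP hpP h hh => ?_, fun hk P hP hpP h hh => ?_⟩
  · obtain ⟨δ, hδ, hδp⟩ := GaloisModel.exists_mem_Delta_reduction_eq_pow r hrp k
    refine GaloisModel.nonempty_quotient_pow_equiv_galoisRing_of_pow_sub_dvd (hp0 _)
      (pow_ne_zero k (Fact.out : r.Prime).ne_zero)
      (GaloisModel.natCast_dvd_pow_sub_self r _ hδ hδp) hn0 P hpP (fun f hf => ?_) hh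
    obtain ⟨δ', hδ', hδf⟩ := GaloisModel.exists_mem_Delta_reduction_eq r _ hrp P hpP hf
    exact GaloisModel.pow_dvd_of_reduction_eq_pow r hrp hδ' hδf
  · obtain ⟨δ, hδ, hδp⟩ := GaloisModel.exists_mem_Delta_reduction_eq_self r hrp hk
    exact GaloisModel.nonempty_quotient_pow_equiv_galoisRing_of_pow_sub_dvd (hp0 _) one_ne_zero
      (GaloisModel.natCast_dvd_pow_sub_self r _ hδ (by rw [hδp, pow_one])) hn0 P hpP
      (fun f _ => one_dvd f) hh
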